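/- For $n\ge 1$ let $B_n^+$ be the monoid of positive $n$-strand braids, generated by $\sigma_1,\dots,\sigma_{n-1}$ subject to $\sigma_i\sigma_j=\sigma_j\sigma_i$ for $|i-j|\ge 2$ and $\sigma_i\sigma_j\sigma_i=\sigma_j\sigma_i\sigma_j$ for $|i-j|=1$; view $B_{n-1}^+$ as the submonoid of $B_n^+$ generated by $\sigma_1,\dots,\sigma_{n-2}$, and let $\Phi_n$ be the automorphism of $B_n^+$ exchanging $\sigma_i$ and $\sigma_{n-i}$ for each $i$. For $n\ge 3$, the $n$-splitting of $x\in B_n^+$ is the unique sequence $(x_p,\dots,x_1)$, $p\ge 1$, of elements of $B_{n-1}^+$ such that $$x=\Phi_n^{p-1}(x_p)\cdots\Phi_n(x_2)\,x_1$$ and, for each $r$ with $2\le r\le p$, the only $\sigma_i$ that is a right divisor of $\Phi_n^{p-r}(x_p)\cdots\Phi_n(x_{r+1})\,x_r$ is $\sigma_1$; the number $p$ is the $n$-breadth of $x$. The relation $<^+$ on $B_n^+$, $n\ge 2$, is defined inductively: on $B_2^+$, $\sigma_1^a<^+\sigma_1^b$ if and only if $a<b$; for $n\ge3$, if $x,y\in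 B_n^+$ have $n$-splittings $(x_p,\dots,x_1)$ and $(y_q,\dots,y_1)$, then $x<^+y$ if and only if either $p<q$, or $p=q$ and there is $r\le p$ with $x_{r'}=y_{r'}$ for $p\ge r'>r$ and $x_r<^+y_r$ in $B_{n-1}^+$. Write $x\le^+y$ for "$x<^+y$ or $x=y$". Finally put $\delta_n=\sigma_{n-1}\cdots\sigma_1$ and, for $d\ge1$, $$\widehat\Delta_{n,d}=\Phi_n^{d}(\delta_n)\cdots\Phi_n^2(\delta_n)\,\Phi_n(\delta_n),$$ the zigzag $\cdots\sigma_{n-1}\cdots\sigma_1\,\sigma_1\cdots\sigma_{n-1}$ of length $d(n-1)$. **Proposition.** Let $n\ge 3$ and $p\ge 2$. Then $\widehat\Delta_{n,p-1}$ is the least upper bound, with respect to $\le^+$, of the set of elements of $B_n^+$ whose $n$-breadth is at most $p$: every such element $x$ satisfies $x\le^+\widehat\Delta_{n,p-1}$, and $\widehat\Delta_{n,p-1}\le^+ c$ holds for every $c\in B_n^+$ that satisfies $x\le^+ c$ for all such $x$. -/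

import Mathlib

/-- The relations of Artin's presentation of the monoid of positive `n`-strand braids. The
generator `σ_{i+1}` (`0 ≤ i < n - 1`) is indexed by `i : Fin (n - 1)`. -/
inductive BraidRel (n : ℕ) : FreeMonoid (Fin (n - 1)) → FreeMonoid (Fin (n - 1)) → Prop
  | comm (i j : Fin (n - 1)) (h : (i : ℕ) + 2 ≤ j ∨ (j : ℕ) + 2 ≤ i) :
      BraidRel n (FreeMonoid.of i * FreeMonoid.of j) (FreeMonoid.of j * FreeMonoid.of i)
  | braid (i j : Fin (n - 1)) (h : (i : ℕ) + 1 = j ∨ (j : ℕ) + 1 = i) :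
      BraidRel n (FreeMonoid.of i * FreeMonoid.of j * FreeMonoid.of i)
        (FreeMonoid.of j * FreeMonoid.of i * FreeMonoid.of j)

/-- The monoid `B_n^+` of positive `n`-strand braids. -/
abbrev PosBraid (n : ℕ) : Type := PresentedMonoid (BraidRel n)

namespace PosBraid

/-- The generators; `σ i` is the braid usually written `σ_{i+1}`. -/
def σ {n : ℕ} (i : Fin (n - 1)) : PosBraid n := PresentedMonoid.of (BraidRel n) i

theorem σ_comm {n : ℕ} (i j : Fin (n - 1)) (h : (i : ℕ) + 2 ≤ j ∨ (j : ℕ) + 2 ≤ i) :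
    (σ i * σ j : PosBraid n) = σ j * σ i :=
  PresentedMonoid.mk_eq_mk_of_rel (BraidRel.comm i j h)

theorem σ_braid {n : ℕ} (i j : Fin (n - 1)) (h : (i : ℕ) + 1 = j ∨ (j : ℕ) + 1 = i) :
    (σ i * σ j * σ i : PosBraid n) = σ j * σ i * σ j :=
  PresentedMonoid.mk_eq_mk_of_rel (BraidRel.braid i j h)

/-- The flip `Φ_n` of `B_n^+`, which exchanges `σ_i` and `σ_{n-i}`. -/
def flip (n : ℕ) : PosBraid n →* PosBraid n :=
  PresentedMonoid.lift (fun i => σ i.rev) (by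
    rintro _ _ (⟨i, j, h⟩ | ⟨i, j, h⟩)
    · simp only [map_mul, FreeMonoid.lift_eval_of]
      exact σ_comm _ _ (by simp only [Fin.val_rev]; omega)
    · simp only [map_mul, FreeMonoid.lift_eval_of]
      exact σ_braid _ _ (by simp only [Fin.val_rev]; omega))

/-- The inclusion of `B_{n-1}^+` in `B_n^+`, which maps `σ_i` to `σ_i`. -/
def incl (n : ℕ) : PosBraid (n - 1) →* PosBraid n :=
  PresentedMonoid.lift (fun i => σ (i.castLE (Nat.sub_le (n - 1) 1))) (by
    rintro _ _ (⟨i, j, h⟩ | ⟨i, j, h⟩)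
    · simp only [map_mul, FreeMonoid.lift_eval_of]
      exact σ_comm _ _ h
    · simp only [map_mul, FreeMonoid.lift_eval_of]
      exact σ_braid _ _ h)

/-- `y` is a right divisor of `x`. -/
def IsRightDivisor {n : ℕ} (y x : PosBraid n) : Prop := ∃ z, x = z * y

/-- The braid `Φ_n^{p-1}(x_p) ⋯ Φ_n(x_2) x_1` of `B_n^+` described by a sequence
`(x_p, …, x_1)` of braids of `B_{n-1}^+`. The list is in this order: its head is `x_p`. -/
def eval (n : ℕ) (s : List (PosBraid (n - 1))) : PosBraid n :=
  s.foldl (fun y x => flip n y * incl n x) 1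

/-- `s = (x_p, …, x_1)`, with `p ≥ 1`, is the `n`-splitting of `x`: the sequence `s` describes
`x`, and, for `p ≥ r ≥ 2`, the only `σ_i` that is a right divisor of
`Φ_n^{p-r}(x_p) ⋯ Φ_n(x_{r+1}) x_r` is `σ_1`. The latter products are described by the
nonempty proper prefixes of `s`. -/
def IsSplitting {n : ℕ} (x : PosBraid n) (s : List (PosBraid (n - 1))) : Prop :=
  s ≠ [] ∧ x = eval n s ∧
    ∀ t u, s = t ++ u → t ≠ [] → u ≠ [] →
      ∀ i : Fin (n - 1), IsRightDivisor (σ i) (eval n t) ↔ (i : ℕ) = 0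

/-- The `n`-breadth of `x`, i.e. the length of its `n`-splitting, is `p`. -/
def HasBreadth {n : ℕ} (x : PosBraid n) (p : ℕ) : Prop :=
  ∃ s, IsSplitting x s ∧ s.length = p

/-- The relation `x <_n^+ y` on `B_n^+`, for `n ≥ 2`: on `B_2^+` compare exponents of `σ_1`; on
`B_n^+` with `n ≥ 3` compare the `n`-splittings, first by length and then lexicographically from
the left with respect to `<_{n-1}^+`. (For `n ≤ 1` the monoid `B_n^+` is trivial.) -/
def lt : (n : ℕ) → PosBraid n → PosBraid n → Prop
  | 0, _, _ => False
  | 1, _, _ => False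
  | 2, x, y => ∃ p q : ℕ, p < q ∧ x = σ 0 ^ p ∧ y = σ 0 ^ q
  | n + 3, x, y => ∃ s t : List (PosBraid (n + 2)),
      IsSplitting (n := n + 3) x s ∧ IsSplitting (n := n + 3) y t ∧ List.Shortlex (lt (n + 2)) s t

/-- The relation `x ≤_n^+ y`. -/
def le (n : ℕ) (x y : PosBraid n) : Prop := lt n x y ∨ x = y

/-- `b` is a least upper bound of `S` with respect to `≤_n^+`. -/
def IsLeastUpperBound {n : ℕ} (S : Set (PosBraid n)) (b : PosBraid n) : Prop :=
  (∀ x ∈ S, le n x b) ∧ ∀ c, (∀ x ∈ S, le n x c) → le n b c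

/-- `δ_n = σ_{n-1} ⋯ σ_1`. -/
def δ (n : ℕ) : PosBraid n := ((List.finRange (n - 1)).reverse.map σ).prod

/-- The zigzag `Φ_n^d(δ_n) ⋯ Φ_n^2(δ_n) Φ_n(δ_n)` of length `d (n - 1)`, for `d ≥ 1`. -/
def zigzag (n d : ℕ) : PosBraid n :=
  ((List.range d).reverse.map fun k => (flip n)^[k + 1] (δ n)).prod

end PosBraid

/-! Write p = d + 2. The zigzag has the splitting (σ_1, δ_{n-1}σ_1, …, δ_{n-1}σ_1, δ_{n-1}, 1) with
d = p - 2 copies of δ_{n-1}σ_1 (`isSplitting_zigzag`). Its breadth is therefore p + 1, and it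
exceeds every braid of breadth at most p.

Now let c be an upper bound. Its breadth is not at most p: enlarging the last entry of its splitting
would give a greater braid of the same breadth, against asymmetry of the order. If the breadth
exceeds p + 1, then c is above the zigzag by length alone. If it equals p + 1, the splitting of c
dominates that of the zigzag entry by entry (`forall₂_le_of_prefix`), as follows. The first entry is
nontrivial, so at least σ_1. Before a later entry y, the preceding prefix ends with σ_1, which the
flip turns into σ_{n-1}. Hence, unless y is the last entry, σ_1 is the only generator that can be a
right divisor of σ_{n-1}y. Induction on the number of strands (`δ_mul_pow_le_or`) then gives y ≥
δ_{n-1}, and even y ≥ δ_{n-1}σ_1 unless y = δ_{n-1}. That equality can occur only just before the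
last entry: otherwise Φ_n(δ_n) would move past the next entry and leave σ_{n-1} as a forbidden right
divisor (`ne_δ_of_endsWithFirst`).

Comparing splittings requires their uniqueness. It rests on Garside's lemma (`matched_of_mul_σ_eq`),
which yields right cancellation of generators and common left multiples inside B_{n-1}^+. Of the
order itself only asymmetry is needed, not linearity. -/

namespace PosBraid

/-! ### Length -/

/-- The length of a positive braid, as a monoid homomorphism. -/
def lengthHom (n : ℕ) : PosBraid n →* Multiplicative ℕ :=
  PresentedMonoid.lift (fun _ => Multiplicative.ofAdd 1) (by
    rintro _ _ (⟨i, j, h⟩ | ⟨i, j, h⟩) <;> rfl)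

/-- The number of letters in any word representing a positive braid. -/
def length {n : ℕ} (x : PosBraid n) : ℕ := (lengthHom n x).toAdd

@[simp] theorem length_one {n : ℕ} : length (1 : PosBraid n) = 0 := by simp [length]

@[simp] theorem length_mul {n : ℕ} (x y : PosBraid n) : length (x * y) = length x + length y := by
  simp [length]

@[simp] theorem length_σ {n : ℕ} (i : Fin (n - 1)) : length (σ i) = 1 := rfl

@[simp] theorem length_pow {n : ℕ} (x : PosBraid n) (k : ℕ) : length (x ^ k) = k * length x := by
  simp [length]

/-- A positive braid is trivial or ends with some generator. -/
theorem eq_one_or_eq_mul_σ {n : ℕ} (x : PosBraid n) : x = 1 ∨ ∃ y i, x = y * σ i := by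
  obtain ⟨w, rfl⟩ := PresentedMonoid.surjective_mk x
  induction w using List.reverseRecOn with
  | nil => exact Or.inl rfl
  | append_singleton l i _ => exact Or.inr ⟨PresentedMonoid.mk _ (FreeMonoid.ofList l), i, rfl⟩

theorem length_eq_zero {n : ℕ} {x : PosBraid n} (h : length x = 0) : x = 1 := by
  rcases eq_one_or_eq_mul_σ x with hx | ⟨y, i, rfl⟩
  · exact hx
  · simp at h

@[elab_as_elim]
theorem right_induction {n : ℕ} {P : PosBraid n → Prop} (one : P 1)
    (mul_σ : ∀ x i, P x → P (x * σ i)) (x : PosBraid n) : P x := by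
  induction h : length x generalizing x with
  | zero => rwa [length_eq_zero h]
  | succ k ih =>
    rcases eq_one_or_eq_mul_σ x with rfl | ⟨y, i, rfl⟩
    · exact one
    · exact mul_σ _ _ (ih _ (by simpa using h))

/-! ### Right lcms of generators -/

/-- The braid `c` for which `c * σ i` is the least common left multiple of `σ i` and `σ j`. -/
def compl {n : ℕ} (i j : Fin (n - 1)) : PosBraid n :=
  if i = j then 1 else if (i : ℕ) + 1 = j ∨ (j : ℕ) + 1 = i then σ i * σ j else σ j

theorem compl_self {n : ℕ} (i : Fin (n - 1)) : compl i i = (1 : PosBraid n) := by simp [compl]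

theorem compl_adj {n : ℕ} {i j : Fin (n - 1)} (h : (i : ℕ) + 1 = j ∨ (j : ℕ) + 1 = i) :
    compl i j = (σ i * σ j : PosBraid n) := by
  have : i ≠ j := by rintro rfl; omega
  simp [compl, this, h]

theorem compl_far {n : ℕ} {i j : Fin (n - 1)} (h : (i : ℕ) + 2 ≤ j ∨ (j : ℕ) + 2 ≤ i) :
    compl i j = (σ j : PosBraid n) := by
  have h1 : i ≠ j := by rintro rfl; omega
  have h2 : ¬ ((i : ℕ) + 1 = j ∨ (j : ℕ) + 1 = i) := by omega
  simp [compl, h1, h2]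

theorem fin_eq_or_adj_or_far {k : ℕ} (i j : Fin k) : i = j ∨
    ((i : ℕ) + 1 = j ∨ (j : ℕ) + 1 = i) ∨ ((i : ℕ) + 2 ≤ j ∨ (j : ℕ) + 2 ≤ i) := by
  rw [Fin.ext_iff]; omega

theorem compl_mul {n : ℕ} (i j : Fin (n - 1)) :
    (compl i j * σ i : PosBraid n) = compl j i * σ j := by
  rcases fin_eq_or_adj_or_far i j with rfl | h | h
  · rfl
  · rw [compl_adj h, compl_adj h.symm]; exact σ_braid i j h
  · rw [compl_far h, compl_far h.symm]; exact (σ_comm i j h).symm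

/-- `x * σ i` and `y * σ j` are equal because both are the same multiple of the least common
left multiple of `σ i` and `σ j`. -/
def Matched {n : ℕ} (x : PosBraid n) (i : Fin (n - 1)) (y : PosBraid n) (j : Fin (n - 1)) : Prop :=
  ∃ z, x = z * compl i j ∧ y = z * compl j i

theorem Matched.symm {n : ℕ} {x y : PosBraid n} {i j : Fin (n - 1)} (h : Matched x i y j) :
    Matched y j x i := by
  obtain ⟨z, hx, hy⟩ := h
  exact ⟨z, hy, hx⟩

theorem Matched.mul_left {n : ℕ} {x y : PosBraid n} {i j : Fin (n - 1)} (h : Matched x i y j)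
    (u : PosBraid n) : Matched (u * x) i (u * y) j := by
  obtain ⟨z, hx, hy⟩ := h
  exact ⟨u * z, by rw [hx, mul_assoc], by rw [hy, mul_assoc]⟩

theorem matched_self {n : ℕ} {x y : PosBraid n} {i : Fin (n - 1)} :
    Matched x i y i ↔ x = y := by
  simp [Matched, compl_self, eq_comm]

theorem matched_adj {n : ℕ} {x y : PosBraid n} {i j : Fin (n - 1)}
    (h : (i : ℕ) + 1 = j ∨ (j : ℕ) + 1 = i) :
    Matched x i y j ↔ ∃ z, x = z * σ i * σ j ∧ y = z * σ j * σ i := by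
  simp [Matched, compl_adj h, compl_adj h.symm, mul_assoc]

theorem matched_far {n : ℕ} {x y : PosBraid n} {i j : Fin (n - 1)}
    (h : (i : ℕ) + 2 ≤ j ∨ (j : ℕ) + 2 ≤ i) :
    Matched x i y j ↔ ∃ z, x = z * σ j ∧ y = z * σ i := by
  simp [Matched, compl_far h, compl_far h.symm]

/-- Equal braids of length at most `L` that end with known generators are matched. -/
def MatchedBelow (n L : ℕ) : Prop :=
  ∀ (x y : PosBraid n) (i j : Fin (n - 1)), length x < L → x * σ i = y * σ j → Matched x i y j

/-! ### Braid identities in three generators -/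

section Words

variable {M : Type*} [Monoid M] {a b c : M}

theorem word_identity_bacab (hbc : b * c = c * b) (hab : a * b * a = b * a * b)
    (hac : a * c * a = c * a * c) (g : M) :
    g * b * a * c * a * b = g * c * a * b * a * c := by
  have h : b * a * c * a * b = c * a * b * a * c := calc
    b * a * c * a * b = b * (a * c * a) * b := by simp only [mul_assoc]
    _ = b * c * a * (c * b) := by rw [hac]; simp only [mul_assoc]
    _ = c * b * a * (b * c) := by rw [hbc]
    _ = c * (b * a * b) * c := by simp only [mul_assoc]
    _ = c * a * b * a * c := by rw [← hab]; simp only [mul_assoc]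
  simpa only [mul_assoc] using congrArg (g * ·) h

theorem word_identity_abcab (hbc : b * c = c * b) (hab : a * b * a = b * a * b)
    (hac : a * c * a = c * a * c) (g : M) :
    g * a * b * c * a * b = g * c * a * b * c * a := by
  have h : a * b * c * a * b = c * a * b * c * a := calc
    a * b * c * a * b = a * (b * c) * a * b := by simp only [mul_assoc]
    _ = a * c * (b * a * b) := by rw [hbc]; simp only [mul_assoc]
    _ = a * c * a * (b * a) := by rw [← hab]; simp only [mul_assoc]
    _ = c * a * (c * b) * a := by rw [hac]; simp only [mul_assoc]
    _ = c * a * b * c * a := by rw [← hbc]; simp only [mul_assoc]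
  simpa only [mul_assoc] using congrArg (g * ·) h

theorem word_identity_abcab_of_comm (hac : a * c = c * a) (hab : a * b * a = b * a * b)
    (hbc : b * c * b = c * b * c) (g : M) :
    g * a * b * c * a * b = g * b * a * c * b * c := by
  have h : a * b * c * a * b = b * a * c * b * c := calc
    a * b * c * a * b = a * b * (c * a) * b := by simp only [mul_assoc]
    _ = a * b * a * c * b := by rw [← hac]; simp only [mul_assoc]
    _ = b * a * (b * c * b) := by rw [hab]; simp only [mul_assoc]
    _ = b * a * c * b * c := by rw [hbc]; simp only [mul_assoc]
  simpa only [mul_assoc] using congrArg (g * ·) h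

theorem word_identity_cab (hac : a * c = c * a) (hbc : b * c = c * b) (g : M) :
    g * c * a * b = g * a * b * c := by
  have h : c * a * b = a * b * c := by grind
  simpa only [mul_assoc] using congrArg (g * ·) h

end Words

/-! ### Transitivity of matching -/

section Transitivity

variable {n L : ℕ} {x y w : PosBraid n} {i j k : Fin (n - 1)}

/-- The two expressions for `y` are matched with each other, and so are the shorter equalities that
result, until `y * σ j` is visibly a multiple of the common multiple of all three generators. A word
identity then rewrites `x` and `w`. -/
theorem Matched.trans_adj_far (H : MatchedBelow n L) (hL : length x ≤ L)
    (hij : (i : ℕ) + 1 = j ∨ (j : ℕ) + 1 = i) (hjk : (j : ℕ) + 2 ≤ k ∨ (k : ℕ) + 2 ≤ j)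
    (h₁ : Matched x i y j) (h₂ : Matched y j w k) : Matched x i w k := by
  obtain ⟨a, rfl, ha⟩ := (matched_adj hij).1 h₁
  obtain ⟨b, rfl, rfl⟩ := (matched_far hjk).1 h₂
  simp only [length_mul, length_σ] at hL
  have hik : i ≠ k := by rintro rfl; omega
  have cjk : (σ j * σ k : PosBraid n) = σ k * σ j := σ_comm j k hjk
  have bij : (σ i * σ j * σ i : PosBraid n) = σ j * σ i * σ j := σ_braid i j hij
  rcases fin_eq_or_adj_or_far i k with h | h | h
  · exact absurd h hik
  · have bik : (σ i * σ k * σ i : PosBraid n) = σ k * σ i * σ k := σ_braid i k h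
    obtain ⟨e, h3, rfl⟩ := (matched_adj h).1
      (H _ _ _ _ (by simp only [length_mul, length_σ]; omega) ha.symm)
    obtain ⟨f, rfl, h5⟩ := (matched_far hjk).1 (H _ _ _ _ (by omega) h3)
    have hl := congrArg length h3
    simp only [length_mul, length_σ] at hl hL
    obtain ⟨g, rfl, rfl⟩ := (matched_adj hij).1 (H _ _ _ _ (by omega) h5)
    refine (matched_adj h).2 ⟨g * σ k * σ i * σ j, ?_, ?_⟩
    · exact word_identity_bacab cjk bij bik g
    · exact word_identity_abcab cjk bij bik g
  · have cik : (σ i * σ k : PosBraid n) = σ k * σ i := σ_comm i k h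
    obtain ⟨e, h3, rfl⟩ := (matched_far h).1
      (H _ _ _ _ (by simp only [length_mul, length_σ]; omega) ha.symm)
    obtain ⟨f, rfl, rfl⟩ := (matched_far hjk).1 (H _ _ _ _ (by omega) h3)
    refine (matched_far h).2 ⟨f * σ i * σ j, ?_, ?_⟩
    · exact word_identity_cab cik cjk f
    · simpa only [mul_assoc] using congrArg (f * ·) bij.symm

theorem Matched.trans_adj_adj (H : MatchedBelow n L) (hL : length x ≤ L) (hik : i ≠ k)
    (hij : (i : ℕ) + 1 = j ∨ (j : ℕ) + 1 = i) (hjk : (j : ℕ) + 1 = k ∨ (k : ℕ) + 1 = j)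
    (h₁ : Matched x i y j) (h₂ : Matched y j w k) : Matched x i w k := by
  obtain ⟨a, rfl, ha⟩ := (matched_adj hij).1 h₁
  obtain ⟨b, rfl, rfl⟩ := (matched_adj hjk).1 h₂
  have hl := congrArg length ha
  simp only [length_mul, length_σ] at hL hl
  have h : (i : ℕ) + 2 ≤ k ∨ (k : ℕ) + 2 ≤ i := by
    have := Fin.val_ne_of_ne hik
    omega
  have bjk : (σ j * σ k * σ j : PosBraid n) = σ k * σ j * σ k := σ_braid j k hjk
  have bij : (σ i * σ j * σ i : PosBraid n) = σ j * σ i * σ j := σ_braid i j hij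
  have cik : (σ i * σ k : PosBraid n) = σ k * σ i := σ_comm i k h
  obtain ⟨e, h3, h4⟩ := (matched_far h).1
    (H _ _ _ _ (by simp only [length_mul, length_σ]; omega) ha.symm)
  obtain ⟨f, rfl, rfl⟩ := (matched_adj hjk).1 (H _ _ _ _ (by omega) h3)
  obtain ⟨g, rfl, h5⟩ := (matched_adj hij.symm).1 (H _ _ _ _ (by omega) h4)
  have hl5 := congrArg length h5
  simp only [length_mul, length_σ] at hL hl hl5
  have h6 := matched_self.1 (H _ _ _ _ (by simp only [length_mul, length_σ]; omega) h5)
  obtain ⟨q, rfl, rfl⟩ := (matched_far h.symm).1 (H _ _ _ _ (by omega) h6)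
  refine (matched_far h).2 ⟨q * σ j * σ i * σ k * σ j, ?_, ?_⟩
  · exact word_identity_abcab_of_comm cik bij bjk q
  · rw [word_identity_abcab_of_comm cik.symm bjk.symm bij.symm q, mul_assoc _ (σ k) (σ i), ← cik,
      ← mul_assoc]

theorem Matched.trans_far_far (H : MatchedBelow n L) (hL : length x ≤ L) (hik : i ≠ k)
    (hij : (i : ℕ) + 2 ≤ j ∨ (j : ℕ) + 2 ≤ i) (hjk : (j : ℕ) + 2 ≤ k ∨ (k : ℕ) + 2 ≤ j)
    (h₁ : Matched x i y j) (h₂ : Matched y j w k) : Matched x i w k := by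
  obtain ⟨a, rfl, ha⟩ := (matched_far hij).1 h₁
  obtain ⟨b, rfl, rfl⟩ := (matched_far hjk).1 h₂
  simp only [length_mul, length_σ] at hL
  have cij : (σ i * σ j : PosBraid n) = σ j * σ i := σ_comm i j hij
  have cjk : (σ j * σ k : PosBraid n) = σ k * σ j := σ_comm j k hjk
  have hm := H _ _ _ _ (by omega) ha.symm
  rcases fin_eq_or_adj_or_far i k with h | h | h
  · exact absurd h hik
  · obtain ⟨e, rfl, rfl⟩ := (matched_adj h).1 hm
    exact (matched_adj h).2 ⟨e * σ j, (word_identity_cab cij cjk.symm e).symm,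
      (word_identity_cab cjk.symm cij e).symm⟩
  · obtain ⟨e, rfl, rfl⟩ := (matched_far h).1 hm
    exact (matched_far h).2 ⟨e * σ j, by rw [mul_assoc, ← cjk, mul_assoc],
      by rw [mul_assoc, cij, mul_assoc]⟩

/-- The inductive core of Garside's lemma: a chain of relations through a third last letter
collapses to one matching, given that strictly shorter braids already match. -/
theorem Matched.trans (H : MatchedBelow n L) (hL : length x ≤ L)
    (hxy : length x = length y) (hyw : length y = length w)
    (h₁ : Matched x i y j) (h₂ : Matched y j w k) : Matched x i w k := by
  rcases eq_or_ne i k with rfl | hik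
  -- Returning to the letter `i` demands equality, obtained by cancelling in shorter braids.
  · obtain ⟨a, rfl, ha⟩ := h₁
    obtain ⟨b, rfl, rfl⟩ := h₂
    rw [matched_self]
    rcases fin_eq_or_adj_or_far i j with rfl | h | h
    · exact ha.symm
    · rw [compl_adj h.symm, ← mul_assoc, ← mul_assoc] at ha
      rw [compl_adj h] at hL
      simp only [length_mul, length_σ] at hL
      have h1 := matched_self.1
        (H _ _ _ _ (by simp only [length_mul, length_σ]; omega) ha.symm)
      rw [matched_self.1 (H _ _ _ _ (by omega) h1)]
    · rw [compl_far h.symm] at ha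
      rw [compl_far h] at hL
      simp only [length_mul, length_σ] at hL
      rw [matched_self.1 (H _ _ _ _ (by omega) ha.symm)]
  · rcases fin_eq_or_adj_or_far i j with rfl | hij | hij
    · rwa [matched_self.1 h₁]
    · rcases fin_eq_or_adj_or_far j k with rfl | hjk | hjk
      · rwa [← matched_self.1 h₂]
      · exact Matched.trans_adj_adj H hL hik hij hjk h₁ h₂
      · exact Matched.trans_adj_far H hL hij hjk h₁ h₂
    · rcases fin_eq_or_adj_or_far j k with rfl | hjk | hjk
      · rwa [← matched_self.1 h₂]
      · exact (Matched.trans_adj_far H (by omega) hjk.symm hij.symm h₂.symm h₁.symm).symm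
      · exact Matched.trans_far_far H hL hik hij hjk h₁ h₂

end Transitivity

/-! ### Garside's lemma by a congruence on words -/

/-- The image of a word in the braid monoid. -/
abbrev ofWord (n : ℕ) : FreeMonoid (Fin (n - 1)) →* PosBraid n := PresentedMonoid.mk (BraidRel n)

theorem length_ofWord {n : ℕ} (w : FreeMonoid (Fin (n - 1))) :
    length (ofWord n w) = FreeMonoid.length w := by
  induction w using FreeMonoid.inductionOn' with
  | one => simp
  | of_mul i w ih =>
    rw [map_mul, length_mul, ih, FreeMonoid.length_mul, FreeMonoid.length_of]
    rfl

theorem word_eq_one_or {α : Type*} (w : FreeMonoid α) :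
    w = 1 ∨ ∃ v i, w = v * FreeMonoid.of i := by
  induction w using List.reverseRecOn with
  | nil => exact Or.inl rfl
  | append_singleton l i _ => exact Or.inr ⟨FreeMonoid.ofList l, i, rfl⟩

theorem mul_of_inj {α : Type*} {v w : FreeMonoid α} {i j : α}
    (h : v * FreeMonoid.of i = w * FreeMonoid.of j) : v = w ∧ i = j := by
  have := congrArg FreeMonoid.toList h
  simpa using List.append_inj' this rfl

/-- Two words represent the same braid, and, if they are short, their last letters match. -/
def WordMatched (n L : ℕ) (v w : FreeMonoid (Fin (n - 1))) : Prop :=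
  ofWord n v = ofWord n w ∧ (FreeMonoid.length v ≤ L + 1 → ∀ v' w' i j,
    v = v' * FreeMonoid.of i → w = w' * FreeMonoid.of j → Matched (ofWord n v') i (ofWord n w') j)

theorem length_eq_of_ofWord_eq {n : ℕ} {v w : FreeMonoid (Fin (n - 1))}
    (h : ofWord n v = ofWord n w) : FreeMonoid.length v = FreeMonoid.length w := by
  rw [← length_ofWord, h, length_ofWord]

/-- If short words match, then `WordMatched` is a congruence. -/
def wordCon {n L : ℕ} (H : MatchedBelow n L) : Con (FreeMonoid (Fin (n - 1))) where
  r := WordMatched n L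
  iseqv := by
    refine ⟨fun v => ⟨rfl, ?_⟩, fun {v w} h => ⟨h.1.symm, ?_⟩, fun {u v w} h₁ h₂ =>
      ⟨h₁.1.trans h₂.1, ?_⟩⟩
    · rintro - v' w' i j rfl h
      obtain ⟨rfl, rfl⟩ := mul_of_inj h
      exact matched_self.2 rfl
    · intro hl v' w' i j hv hw
      exact (h.2 (by rwa [length_eq_of_ofWord_eq h.1]) _ _ _ _ hw hv).symm
    · intro hl u' w' i k hu hw
      have l1 := length_eq_of_ofWord_eq h₁.1
      have l2 := length_eq_of_ofWord_eq h₂.1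
      rcases word_eq_one_or v with rfl | ⟨v', j, rfl⟩
      · subst hu
        simp at l1
      · have m1 := h₁.2 hl _ _ _ _ hu rfl
        have m2 := h₂.2 (by omega) _ _ _ _ rfl hw
        subst hu hw
        simp only [FreeMonoid.length_mul, FreeMonoid.length_of] at l1 l2 hl
        exact Matched.trans H (by rw [length_ofWord]; omega)
          (by rw [length_ofWord, length_ofWord]; omega)
          (by rw [length_ofWord, length_ofWord]; omega) m1 m2
  mul' := by
    intro v v' w w' h₁ h₂
    refine ⟨by rw [map_mul, map_mul, h₁.1, h₂.1], ?_⟩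
    intro hl a b i j ha hb
    have l2 := length_eq_of_ofWord_eq h₂.1
    rcases word_eq_one_or w with rfl | ⟨c, k, rfl⟩
    · have : w' = 1 := by
        rw [← FreeMonoid.length_eq_zero, ← l2]; simp
      subst this
      rw [mul_one] at ha hb hl
      exact h₁.2 hl _ _ _ _ ha hb
    · rcases word_eq_one_or w' with rfl | ⟨c', k', rfl⟩
      · simp at l2
      · rw [← mul_assoc] at ha hb
        obtain ⟨rfl, rfl⟩ := mul_of_inj ha
        obtain ⟨rfl, rfl⟩ := mul_of_inj hb
        rw [map_mul, map_mul, ← h₁.1]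
        refine Matched.mul_left (h₂.2 ?_ _ _ _ _ rfl rfl) _
        rw [FreeMonoid.length_mul] at hl
        omega

theorem wordMatched_of_rel {n L : ℕ} {v w : FreeMonoid (Fin (n - 1))} (h : BraidRel n v w) :
    WordMatched n L v w := by
  refine ⟨PresentedMonoid.mk_eq_mk_of_rel h, ?_⟩
  rintro - v' w' i' j' hv hw
  cases h with
  | comm i j h =>
    obtain ⟨rfl, rfl⟩ := mul_of_inj hv
    obtain ⟨rfl, rfl⟩ := mul_of_inj hw
    exact (matched_far h.symm).2 ⟨1, (one_mul _).symm, (one_mul _).symm⟩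
  | braid i j h =>
    obtain ⟨rfl, rfl⟩ := mul_of_inj hv
    obtain ⟨rfl, rfl⟩ := mul_of_inj hw
    refine (matched_adj h).2 ⟨1, ?_, ?_⟩ <;> rw [one_mul, map_mul] <;> rfl

/-- Matching below `L` makes `WordMatched` a congruence. It contains the defining relations, hence
all equalities of braids, and so gives matching one length further. -/
theorem matchedBelow (n L : ℕ) : MatchedBelow n L := by
  induction L with
  | zero => intro x y i j h; simp at h
  | succ L H =>
    intro x y i j hL h
    obtain ⟨v, rfl⟩ := PresentedMonoid.surjective_mk x
    obtain ⟨w, rfl⟩ := PresentedMonoid.surjective_mk y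
    have hle : conGen (BraidRel n) ≤ wordCon H := Con.conGen_le.2 fun _ _ => wordMatched_of_rel
    have h' : ofWord n (v * FreeMonoid.of i) = ofWord n (w * FreeMonoid.of j) := by
      rw [map_mul, map_mul]; exact h
    refine (hle (PresentedMonoid.mk_eq_mk_iff.1 h')).2 ?_ _ _ _ _ rfl rfl
    change length (ofWord n v) < L + 1 at hL
    rw [length_ofWord] at hL
    rw [FreeMonoid.length_mul, FreeMonoid.length_of]
    omega

/-- Garside's lemma: a common left multiple of two generators is a left multiple of their least
common left multiple. -/
theorem matched_of_mul_σ_eq {n : ℕ} {x y : PosBraid n} {i j : Fin (n - 1)}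
    (h : x * σ i = y * σ j) : Matched x i y j :=
  matchedBelow n (length x + 1) _ _ _ _ (Nat.lt_succ_self _) h

theorem mul_σ_right_cancel {n : ℕ} {x y : PosBraid n} {i : Fin (n - 1)}
    (h : x * σ i = y * σ i) : x = y :=
  matched_self.1 (matched_of_mul_σ_eq h)

/-! ### The flip and the inclusion -/

@[simp] theorem flip_σ {n : ℕ} (i : Fin (n - 1)) : flip n (σ i) = σ i.rev := rfl

@[simp] theorem incl_σ {n : ℕ} (i : Fin (n - 1 - 1)) :
    incl n (σ i) = σ (i.castLE (Nat.sub_le (n - 1) 1)) := rfl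

@[simp] theorem flip_flip {n : ℕ} (x : PosBraid n) : flip n (flip n x) = x := by
  induction x using right_induction with
  | one => simp
  | mul_σ x i ih => simp [ih]

theorem flip_injective (n : ℕ) : Function.Injective (flip n) :=
  Function.LeftInverse.injective flip_flip

@[simp] theorem length_flip {n : ℕ} (x : PosBraid n) : length (flip n x) = length x := by
  induction x using right_induction with
  | one => simp
  | mul_σ x i ih => simp [ih]

@[simp] theorem length_incl {n : ℕ} (x : PosBraid (n - 1)) : length (incl n x) = length x := by
  induction x using right_induction with
  | one => simp
  | mul_σ x i ih => simp [ih]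

theorem incl_compl {n : ℕ} (i j : Fin (n - 1 - 1)) : incl n (compl i j) =
    compl (i.castLE (Nat.sub_le (n - 1) 1)) (j.castLE (Nat.sub_le (n - 1) 1)) := by
  simp only [compl, Fin.val_castLE, Fin.castLE_inj]
  split_ifs <;> simp

theorem isRightDivisor_mul {n : ℕ} {x y : PosBraid n} (h : IsRightDivisor x y) (z : PosBraid n) :
    IsRightDivisor x (z * y) := by
  obtain ⟨w, rfl⟩ := h
  exact ⟨z * w, (mul_assoc _ _ _).symm⟩

theorem isRightDivisor_mul_self {n : ℕ} (x z : PosBraid n) : IsRightDivisor x (z * x) := ⟨z, rfl⟩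

theorem isRightDivisor_flip {n : ℕ} {i : Fin (n - 1)} {x : PosBraid n} :
    IsRightDivisor (σ i) (flip n x) ↔ IsRightDivisor (σ i.rev) x := by
  constructor
  · rintro ⟨z, hz⟩
    exact ⟨flip n z, by rw [← flip_flip x, hz]; simp⟩
  · rintro ⟨z, rfl⟩
    exact ⟨flip n z, by simp⟩

theorem not_isRightDivisor_one {n : ℕ} (i : Fin (n - 1)) :
    ¬ IsRightDivisor (σ i) (1 : PosBraid n) := by
  rintro ⟨z, hz⟩
  simpa using congrArg length hz

/-! ### Common multiples in a parabolic submonoid -/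

/-- A common left multiple in `B_n^+` of two braids of `B_{n-1}^+` is a left multiple of a common
left multiple in `B_{n-1}^+`. -/
theorem exists_incl_of_mul_incl_eq {n : ℕ} {y z : PosBraid n} {a b : PosBraid (n - 1)}
    (h : y * incl n b = z * incl n a) :
    ∃ w u v, y = w * incl n u ∧ z = w * incl n v ∧ u * b = v * a := by
  induction hL : length (y * incl n b) using Nat.strong_induction_on generalizing y z a b with
  | _ L ih =>
  rcases eq_one_or_eq_mul_σ a with rfl | ⟨a, i, rfl⟩
  · exact ⟨y, 1, b, by simp, by simpa using h.symm, by simp⟩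
  rcases eq_one_or_eq_mul_σ b with rfl | ⟨b, j, rfl⟩
  · exact ⟨z, a * σ i, 1, by simpa using h, by simp, by simp⟩
  simp only [map_mul, incl_σ, ← mul_assoc] at h
  obtain ⟨w, hw₁, hw₂⟩ := matched_of_mul_σ_eq h
  rw [← incl_compl] at hw₁ hw₂
  have l₁ := congrArg length hw₁
  have l₂ := congrArg length hw₂
  have l₃ := congrArg length h
  simp only [length_mul, length_incl, length_σ, map_mul] at hL l₁ l₂ l₃
  -- Three shorter instances: `y` against `w`, `z` against `w`, and then the two resulting
  -- decompositions of `w` against each other.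
  obtain ⟨w₁, u₁, v₁, rfl, rfl, e₁⟩ := ih _ (by simp only [length_mul, length_incl]; omega) hw₁ rfl
  obtain ⟨w₂, u₂, v₂, rfl, e, e₂⟩ := ih _ (by simp only [length_mul, length_incl]; omega) hw₂ rfl
  simp only [length_mul, length_incl] at hL l₁ l₂ l₃
  obtain ⟨w₃, p, q, rfl, rfl, e₃⟩ := ih _ (by simp only [length_mul, length_incl]; omega) e rfl
  refine ⟨w₃, p * u₁, q * u₂, by simp [mul_assoc], by simp [mul_assoc], ?_⟩
  calc p * u₁ * (b * σ j) = p * (u₁ * b) * σ j := by simp only [mul_assoc]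
    _ = p * v₁ * (compl j i * σ j) := by rw [e₁]; simp only [mul_assoc]
    _ = q * (v₂ * compl i j) * σ i := by rw [e₃, compl_mul]; simp only [mul_assoc]
    _ = q * u₂ * (a * σ i) := by rw [← e₂]; simp only [mul_assoc]

/-- No generator of `B_{n-1}^+` is a right divisor of `y`. -/
def IsReduced {n : ℕ} (y : PosBraid n) : Prop :=
  ∀ i : Fin (n - 1), (i : ℕ) + 1 < n - 1 → ¬ IsRightDivisor (σ i) y

theorem isReduced_one {n : ℕ} : IsReduced (1 : PosBraid n) := fun i _ => not_isRightDivisor_one i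

theorem IsReduced.eq_one_of_mul_incl {n : ℕ} {w : PosBraid n} {u : PosBraid (n - 1)}
    (h : IsReduced (w * incl n u)) : u = 1 := by
  rcases eq_one_or_eq_mul_σ u with hu | ⟨u, i, rfl⟩
  · exact hu
  · refine (h (i.castLE (Nat.sub_le (n - 1) 1)) ?_ ?_).elim
    · have := i.isLt
      rw [Fin.val_castLE]
      omega
    · exact ⟨w * incl n u, by simp [mul_assoc]⟩

/-- The decomposition of a braid into a reduced braid and a braid of `B_{n-1}^+` is unique. -/
theorem IsReduced.unique {n : ℕ} {y z : PosBraid n} {a b : PosBraid (n - 1)} (hy : IsReduced y)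
    (hz : IsReduced z) (h : y * incl n b = z * incl n a) : y = z ∧ b = a := by
  obtain ⟨w, u, v, rfl, rfl, e⟩ := exists_incl_of_mul_incl_eq h
  obtain rfl := hy.eq_one_of_mul_incl
  obtain rfl := hz.eq_one_of_mul_incl
  exact ⟨rfl, by simpa using e⟩

theorem exists_isReduced {n : ℕ} (x : PosBraid n) : ∃ y a, IsReduced y ∧ x = y * incl n a := by
  induction hL : length x using Nat.strong_induction_on generalizing x with
  | _ L ih =>
  by_cases hx : IsReduced x
  · exact ⟨x, 1, hx, by simp⟩
  · simp only [IsReduced, not_forall, not_not] at hx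
    obtain ⟨i, hi, x, rfl⟩ := hx
    obtain ⟨y, a, hy, rfl⟩ := ih (length x) (by simp [← hL]) x rfl
    exact ⟨y, a * σ ⟨i, by omega⟩, hy, by simp [mul_assoc]⟩

/-! ### Splittings -/

/-- The generator `σ_1` is the only one that is a right divisor of `x`. -/
def EndsWithFirst {n : ℕ} (x : PosBraid n) : Prop :=
  ∀ i : Fin (n - 1), IsRightDivisor (σ i) x ↔ (i : ℕ) = 0

theorem EndsWithFirst.isReduced_flip {n : ℕ} {x : PosBraid n} (h : EndsWithFirst x) :
    IsReduced (flip n x) := by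
  intro i hi hd
  rw [isRightDivisor_flip, h] at hd
  simp only [Fin.val_rev] at hd
  omega

@[simp] theorem eval_nil {n : ℕ} : eval n [] = 1 := rfl

@[simp] theorem eval_append_singleton {n : ℕ} (s : List (PosBraid (n - 1)))
    (a : PosBraid (n - 1)) : eval n (s ++ [a]) = flip n (eval n s) * incl n a := by
  simp [eval]

@[simp] theorem eval_singleton {n : ℕ} (a : PosBraid (n - 1)) : eval n [a] = incl n a := by
  simp [eval]

/-- This recursion on the last entry carries both existence and uniqueness of splittings. -/
theorem isSplitting_append_singleton {n : ℕ} {x : PosBraid n} {s : List (PosBraid (n - 1))}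
    {a : PosBraid (n - 1)} : IsSplitting x (s ++ [a]) ↔ x = flip n (eval n s) * incl n a ∧
      (s = [] ∨ IsSplitting (eval n s) s ∧ EndsWithFirst (eval n s)) := by
  constructor
  · rintro ⟨-, h, hs⟩
    refine ⟨by simpa using h, ?_⟩
    rcases eq_or_ne s [] with h0 | h0
    · exact Or.inl h0
    · refine Or.inr ⟨⟨h0, rfl, fun t u htu ht hu => ?_⟩, hs s [a] rfl h0 (by simp)⟩
      exact hs t (u ++ [a]) (by rw [htu, List.append_assoc]) ht (by simp)
  · rintro ⟨h, hs⟩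
    refine ⟨by simp, by simpa using h, fun t u htu ht hu => ?_⟩
    rcases u.eq_nil_or_concat with rfl | ⟨u, b, rfl⟩
    · exact absurd rfl hu
    rw [List.concat_eq_append, ← List.append_assoc] at htu
    obtain ⟨rfl, -⟩ := List.append_inj' htu rfl
    rcases hs with hs | ⟨hs, hs'⟩
    · exact absurd (List.append_eq_nil_iff.1 hs).1 ht
    · rcases eq_or_ne u [] with rfl | hu
      · simpa [EndsWithFirst] using hs'
      · exact hs.2.2 t u rfl ht hu

theorem isSplitting_singleton {n : ℕ} (a : PosBraid (n - 1)) : IsSplitting (incl n a) [a] := by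
  rw [← List.nil_append [a], isSplitting_append_singleton]
  simp

/-- The flipped prefix is reduced, so the last entry is determined by `IsReduced.unique`. An empty
prefix cannot be confused with a nonempty one, since the latter has σ_1 as a right divisor. -/
theorem IsSplitting.unique {n : ℕ} (hn : 2 ≤ n) {x : PosBraid n} {s t : List (PosBraid (n - 1))}
    (hs : IsSplitting x s) (ht : IsSplitting x t) : s = t := by
  induction s using List.reverseRecOn generalizing x t with
  | nil => exact absurd rfl hs.1
  | append_singleton s a ih =>
    rcases t.eq_nil_or_concat with rfl | ⟨t, b, rfl⟩
    · exact absurd rfl ht.1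
    rw [List.concat_eq_append] at ht ⊢
    obtain ⟨hx, hs⟩ := isSplitting_append_singleton.1 hs
    obtain ⟨hx', ht₁⟩ := isSplitting_append_singleton.1 ht
    have reduced : ∀ {r : List (PosBraid (n - 1))},
        r = [] ∨ IsSplitting (eval n r) r ∧ EndsWithFirst (eval n r) →
        IsReduced (flip n (eval n r)) := by
      rintro r (rfl | ⟨-, h⟩)
      · simpa using isReduced_one
      · exact h.isReduced_flip
    obtain ⟨e₁, rfl⟩ := (reduced hs).unique (reduced ht₁) (hx.symm.trans hx')
    replace e₁ := flip_injective n e₁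
    congr 1
    have first : ∀ {y : PosBraid n}, EndsWithFirst y → y ≠ 1 := by
      rintro y h rfl
      exact not_isRightDivisor_one _ ((h ⟨0, by omega⟩).2 rfl)
    rcases hs with rfl | ⟨hs, hs'⟩
    · rcases ht₁ with rfl | ⟨-, ht'⟩
      · rfl
      · exact absurd e₁.symm (first ht')
    · rcases ht₁ with rfl | ⟨ht, -⟩
      · exact absurd e₁ (first hs')
      · exact ih hs (e₁ ▸ ht)

theorem IsReduced.endsWithFirst_flip {n : ℕ} {y : PosBraid n} (h : IsReduced y) (h1 : y ≠ 1) :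
    EndsWithFirst (flip n y) := by
  have key : ∀ i : Fin (n - 1), IsRightDivisor (σ i) y → i.rev.val = 0 := by
    intro i hi
    by_contra hne
    exact h i (by simp only [Fin.val_rev] at hne; omega) hi
  intro i
  rw [isRightDivisor_flip]
  refine ⟨fun hi => by simpa using key _ hi, fun hi => ?_⟩
  rcases eq_one_or_eq_mul_σ y with hy | ⟨z, j, rfl⟩
  · exact absurd hy h1
  · have hj := key j (isRightDivisor_mul_self _ _)
    have : i.rev = j := by
      rw [← Fin.rev_rev j]
      congr 1
      exact Fin.ext (hi.trans hj.symm)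
    rw [this]
    exact isRightDivisor_mul_self _ _

/-- Divisibility by σ_1 forces the split-off entry to be nontrivial, so the remaining braid is
shorter; after a flip it satisfies the same hypothesis. For general braids the length may fail to
drop, but only at the first stage. -/
theorem exists_isSplitting_of_endsWithFirst {n : ℕ} (hn : 3 ≤ n) {x : PosBraid n}
    (hx : EndsWithFirst x) : ∃ s, IsSplitting x s := by
  induction hL : length x using Nat.strong_induction_on generalizing x with
  | _ L ih =>
  obtain ⟨y, a, hy, rfl⟩ := exists_isReduced x
  by_cases h1 : y = 1
  · exact ⟨[a], by simpa [h1] using isSplitting_singleton a⟩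
  · have ha : a ≠ 1 := by
      rintro rfl
      refine hy ⟨0, by omega⟩ (by simp only; omega) ?_
      simpa using (hx ⟨0, by omega⟩).2 rfl
    have ha' : length a ≠ 0 := fun h => ha (length_eq_zero h)
    have hf := hy.endsWithFirst_flip h1
    obtain ⟨s, hs⟩ := ih (length y) (by simp only [length_mul, length_incl] at hL; omega) hf
      (length_flip y)
    refine ⟨s ++ [a], isSplitting_append_singleton.2 ⟨?_, Or.inr ?_⟩⟩
    · rw [← hs.2.1, flip_flip]
    · rw [← hs.2.1]
      exact ⟨hs, hf⟩

/-- Every braid has a splitting. -/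
theorem exists_isSplitting {n : ℕ} (hn : 3 ≤ n) (x : PosBraid n) : ∃ s, IsSplitting x s := by
  obtain ⟨y, a, hy, rfl⟩ := exists_isReduced x
  by_cases h1 : y = 1
  · exact ⟨[a], by simpa [h1] using isSplitting_singleton a⟩
  · have hf := hy.endsWithFirst_flip h1
    obtain ⟨s, hs⟩ := exists_isSplitting_of_endsWithFirst hn hf
    refine ⟨s ++ [a], isSplitting_append_singleton.2 ⟨?_, Or.inr ?_⟩⟩
    · rw [← hs.2.1, flip_flip]
    · rw [← hs.2.1]
      exact ⟨hs, hf⟩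

/-! ### Generators indexed by natural numbers -/

/-- The generator `σ_{i+1}` of `B_n^+` if `i < n - 1`, and `1` otherwise. -/
def gen (n i : ℕ) : PosBraid n := if h : i < n - 1 then σ ⟨i, h⟩ else 1

theorem gen_of_lt {n i : ℕ} (h : i < n - 1) : gen n i = σ ⟨i, h⟩ := by simp [gen, h]

theorem gen_val {n : ℕ} (i : Fin (n - 1)) : gen n i = σ i := gen_of_lt i.isLt

theorem incl_gen {n i : ℕ} (h : i < n - 1) : incl (n + 1) (gen n i) = gen (n + 1) i := by
  have h' : i < n + 1 - 1 := by omega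
  rw [gen_of_lt h, gen_of_lt h']
  rfl

theorem flip_gen {n i : ℕ} (h : i < n - 1) : flip n (gen n i) = gen n (n - 2 - i) := by
  have h' : n - 2 - i < n - 1 := by omega
  rw [gen_of_lt h, gen_of_lt h', flip_σ]
  congr 1
  ext
  simp only [Fin.val_rev]
  omega

theorem gen_comm {n i j : ℕ} (h : i + 2 ≤ j) : gen n i * gen n j = gen n j * gen n i := by
  by_cases hi : i < n - 1
  · by_cases hj : j < n - 1
    · rw [gen_of_lt hi, gen_of_lt hj]
      exact σ_comm _ _ (Or.inl h)
    · simp [gen, hj]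
  · simp [gen, hi]

theorem gen_braid {n i : ℕ} (h : i + 1 < n - 1) :
    gen n i * gen n (i + 1) * gen n i = gen n (i + 1) * gen n i * gen n (i + 1) := by
  rw [gen_of_lt h, gen_of_lt (show i < n - 1 by omega)]
  exact σ_braid _ _ (Or.inl rfl)

theorem isRightDivisor_of_far {n i j : ℕ} (hi : i < n - 1) (hj : j < n - 1)
    (h : i + 2 ≤ j ∨ j + 2 ≤ i) {y : PosBraid n} (hd : IsRightDivisor (gen n i) (y * gen n j)) :
    IsRightDivisor (gen n i) y := by
  rw [gen_of_lt hi, gen_of_lt hj] at *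
  obtain ⟨x, hx⟩ := hd
  obtain ⟨z, hz, -⟩ := (matched_far h.symm).1 (matched_of_mul_σ_eq hx)
  exact ⟨z, hz⟩

theorem eq_mul_mul_of_adj {n i j : ℕ} (hi : i < n - 1) (hj : j < n - 1)
    (h : i + 1 = j ∨ j + 1 = i) {y : PosBraid n} (hd : IsRightDivisor (gen n i) (y * gen n j)) :
    ∃ z, y = z * gen n j * gen n i := by
  rw [gen_of_lt hi, gen_of_lt hj] at *
  obtain ⟨x, hx⟩ := hd
  obtain ⟨z, hz, -⟩ := (matched_adj h.symm).1 (matched_of_mul_σ_eq hx)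
  exact ⟨z, hz⟩

theorem EndsWithFirst.isRightDivisor_gen {n : ℕ} {x : PosBraid n} (h : EndsWithFirst x) {i : ℕ}
    (hi : i < n - 1) : IsRightDivisor (gen n i) x ↔ i = 0 := by
  rw [gen_of_lt hi]
  exact h _

theorem endsWithFirst_of {n : ℕ} {x : PosBraid n} (h0 : IsRightDivisor (gen n 0) x)
    (h : ∀ j, j + 1 < n - 1 → ¬ IsRightDivisor (gen n (j + 1)) x) : EndsWithFirst x := by
  intro i
  rw [← gen_val]
  rcases hi : (i : ℕ) with _ | j
  · simpa using h0
  · simpa using h j (by have := i.isLt; omega)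

theorem isRightDivisor_gen_flip {n i : ℕ} (h : i < n - 1) {x : PosBraid n} :
    IsRightDivisor (gen n (n - 2 - i)) (flip n x) ↔ IsRightDivisor (gen n i) x := by
  rw [← flip_gen h, gen_of_lt h, flip_σ, isRightDivisor_flip, Fin.rev_rev]

/-! ### Descending products -/

/-- The product `σ_k ⋯ σ_1` in `B_n^+`. -/
def desc (n : ℕ) : ℕ → PosBraid n
  | 0 => 1
  | k + 1 => gen n k * desc n k

theorem δ_eq_desc (n : ℕ) : δ n = desc n (n - 1) := by
  have h1 : ∀ k, desc n k = ((List.range k).reverse.map (gen n)).prod := by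
    intro k
    induction k with
    | zero => rfl
    | succ k ih => rw [desc, ih, List.range_succ]; simp
  rw [h1, δ, ← List.map_coe_finRange_eq_range, ← List.map_reverse, List.map_map]
  congr 2
  funext i
  exact (gen_val i).symm

theorem incl_desc {n k : ℕ} (h : k ≤ n - 1) : incl (n + 1) (desc n k) = desc (n + 1) k := by
  induction k with
  | zero => exact map_one (incl (n + 1))
  | succ k ih =>
    rw [desc, desc, ← ih (by omega), ← incl_gen (show k < n - 1 by omega)]
    exact map_mul (incl (n + 1)) _ _

theorem δ_succ (n : ℕ) : δ (n + 2) = gen (n + 2) n * incl (n + 2) (δ (n + 1)) := by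
  rw [δ_eq_desc, δ_eq_desc]
  exact congrArg _ (incl_desc le_rfl).symm

theorem gen_mul_desc {n k j : ℕ} (h : k < j) : gen n j * desc n k = desc n k * gen n j := by
  induction k with
  | zero => simp [desc]
  | succ k ih =>
    rw [desc, ← mul_assoc, ← gen_comm (by omega), mul_assoc, ih (by omega), mul_assoc]

theorem desc_mul_gen {n k j : ℕ} (hj : j + 1 < k) (hk : k ≤ n - 1) :
    desc n k * gen n (j + 1) = gen n j * desc n k := by
  induction k with
  | zero => omega
  | succ k ih =>
    rcases Nat.lt_or_ge (j + 1) k with h | h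
    · rw [desc, mul_assoc, ih h (by omega), ← mul_assoc, ← gen_comm (by omega), mul_assoc]
    · obtain rfl : k = j + 1 := by omega
      have hb := gen_braid (n := n) (i := j) (by omega)
      rw [desc, desc, mul_assoc, mul_assoc, ← gen_mul_desc (Nat.lt_succ_self j), ← mul_assoc,
        ← mul_assoc, ← hb]
      simp only [mul_assoc]

theorem isRightDivisor_of_mul_desc_of_lt {n k i : ℕ} (hk : k < i) (hi : i < n - 1)
    {y : PosBraid n} (h : IsRightDivisor (gen n i) (y * desc n k)) :
    IsRightDivisor (gen n i) y := by
  induction k generalizing y with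
  | zero => simpa [desc] using h
  | succ k ih =>
    rw [desc, ← mul_assoc] at h
    exact isRightDivisor_of_far hi (by omega) (Or.inr hk) (ih (by omega) h)

/-- A divisibility converse of `desc_mul_gen`: far letters are passed unchanged, and the factor
σ_{j+2}σ_{j+1} turns the divisor σ_{j+2} into σ_{j+1}. -/
theorem isRightDivisor_of_mul_desc {n k j : ℕ} (hj : j + 1 < k) (hk : k ≤ n - 1)
    {y : PosBraid n} (h : IsRightDivisor (gen n (j + 1)) (y * desc n k)) :
    IsRightDivisor (gen n j) y := by
  induction k generalizing y with
  | zero => omega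
  | succ k ih =>
    rcases Nat.lt_or_ge (j + 1) k with h' | h'
    · rw [desc, ← mul_assoc] at h
      exact isRightDivisor_of_far (by omega) (by omega) (Or.inl h') (ih h' (by omega) h)
    · obtain rfl : k = j + 1 := by omega
      rw [desc, desc, ← mul_assoc, ← mul_assoc] at h
      obtain ⟨z, hz⟩ := eq_mul_mul_of_adj (by omega) (by omega) (Or.inr rfl)
        (isRightDivisor_of_mul_desc_of_lt (Nat.lt_succ_self j) (by omega) h)
      rw [gen_of_lt (show j + 1 < n - 1 by omega)] at hz
      exact ⟨z, mul_σ_right_cancel hz⟩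

/-- `Φ_n(δ_n)` quasi-commutes with the braids of `B_{n-1}^+`. -/
theorem flip_δ_mul_incl {n : ℕ} (y : PosBraid (n - 1)) :
    ∃ z, flip n (δ n) * incl n y = z * flip n (δ n) := by
  induction y using right_induction with
  | one => exact ⟨1, by simp⟩
  | mul_σ y i ih =>
    obtain ⟨z, hz⟩ := ih
    have hi := i.isLt
    -- The flip of δ_n σ_{j+2} = σ_{j+1} δ_n at j = n - 3 - i, chosen so that σ_{j+2} flips to
    -- σ_{i+1}.
    refine ⟨z * flip n (gen n (n - 3 - i)), ?_⟩
    have h := congrArg (flip n) (desc_mul_gen (n := n) (k := n - 1) (j := n - 3 - i)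
      (by omega) le_rfl)
    rw [← δ_eq_desc, map_mul, map_mul, flip_gen (i := n - 3 - i + 1) (by omega)] at h
    have e : n - 2 - (n - 3 - i + 1) = i := by omega
    rw [e] at h
    rw [map_mul, ← mul_assoc, hz, incl_σ, mul_assoc, mul_assoc, ← h, ← gen_val]
    rfl

theorem isRightDivisor_δ {n : ℕ} (hn : 2 ≤ n) : IsRightDivisor (gen n 0) (δ n) := by
  have h : ∀ k, IsRightDivisor (gen n 0) (desc n (k + 1)) := by
    intro k
    induction k with
    | zero => exact ⟨1, by simp [desc]⟩
    | succ k ih => exact isRightDivisor_mul ih _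
  obtain ⟨k, rfl⟩ : ∃ k, n = k + 2 := ⟨n - 2, by omega⟩
  rw [δ_eq_desc]
  exact h k

/-! ### The splitting of a zigzag -/

theorem zigzag_succ (n d : ℕ) : zigzag n (d + 1) = flip n (zigzag n d) * flip n (δ n) := by
  simp only [zigzag]
  rw [List.range_succ_eq_map, List.reverse_cons, List.map_append, List.prod_append, map_list_prod,
    ← List.map_reverse, List.map_map, List.map_map]
  simp only [List.map_cons, List.map_nil, List.prod_singleton]
  congr 3
  funext k
  exact Function.iterate_succ_apply' _ _ _

theorem flip_zigzag_succ (n d : ℕ) : flip n (zigzag n (d + 1)) = zigzag n d * δ n := by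
  rw [zigzag_succ, map_mul, flip_flip, flip_flip]

/-- Pushing such a divisor through the last δ_n and flipping gives again a generator other than σ_1,
dividing a shorter flipped zigzag. -/
theorem not_isRightDivisor_flip_zigzag {n d j : ℕ} (hj : j + 1 < n - 1) :
    ¬ IsRightDivisor (gen n (j + 1)) (flip n (zigzag n d)) := by
  induction d generalizing j with
  | zero =>
    rw [gen_of_lt hj]
    simpa [zigzag] using not_isRightDivisor_one _
  | succ d ih =>
    intro h
    rw [flip_zigzag_succ, δ_eq_desc] at h
    have h1 := isRightDivisor_of_mul_desc hj le_rfl h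
    rw [← isRightDivisor_gen_flip (by omega)] at h1
    have e : n - 2 - j = n - 3 - j + 1 := by omega
    rw [e] at h1
    exact ih (by omega) h1

theorem endsWithFirst_flip_zigzag {n d : ℕ} (hn : 2 ≤ n) :
    EndsWithFirst (flip n (zigzag n (d + 1))) := by
  refine endsWithFirst_of ?_ fun j hj => not_isRightDivisor_flip_zigzag hj
  rw [flip_zigzag_succ]
  exact isRightDivisor_mul (isRightDivisor_δ hn) _

theorem endsWithFirst_flip_zigzag_mul {n d : ℕ} :
    EndsWithFirst (flip n (zigzag n d) * gen n 0) := by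
  refine endsWithFirst_of (isRightDivisor_mul_self _ _) fun j hj h => ?_
  rcases j with _ | j
  · obtain ⟨z, hz⟩ := eq_mul_mul_of_adj (by omega) (by omega) (Or.inr rfl) h
    exact not_isRightDivisor_flip_zigzag (d := d) hj ⟨_, hz⟩
  · exact not_isRightDivisor_flip_zigzag hj (isRightDivisor_of_far (by omega) (by omega)
      (Or.inr (by omega)) h)

theorem endsWithFirst_gen {n : ℕ} : EndsWithFirst (gen n 0) := by
  simpa [zigzag] using endsWithFirst_flip_zigzag_mul (n := n) (d := 0)

/-- The splitting of a zigzag. -/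
def zigzagSplitting (n d : ℕ) : List (PosBraid n) :=
  gen n 0 :: (List.replicate d (δ n * gen n 0) ++ [δ n, 1])

theorem length_zigzagSplitting (n d : ℕ) : (zigzagSplitting n d).length = d + 3 := by
  simp [zigzagSplitting]

theorem flip_zigzag_mul_δ {n d : ℕ} : flip (n + 2) (flip (n + 2) (zigzag (n + 2) d) *
    gen (n + 2) 0) * incl (n + 2) (δ (n + 1)) = flip (n + 2) (zigzag (n + 2) (d + 1)) := by
  rw [flip_zigzag_succ, δ_succ, map_mul, flip_flip, flip_gen (by omega), mul_assoc]
  rfl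

/-- The σ_1 ending one prefix flips to σ_{n-1}; the δ_{n-1} of the next entry completes it to δ_n,
and the σ_1 after it starts the next turn. -/
theorem isSplitting_zigzagPrefix (n d : ℕ) :
    IsSplitting (n := n + 3) (flip (n + 3) (zigzag (n + 3) d) * gen (n + 3) 0)
      (gen (n + 2) 0 :: List.replicate d (δ (n + 2) * gen (n + 2) 0)) := by
  induction d with
  | zero =>
    have h : flip (n + 3) (zigzag (n + 3) 0) * gen (n + 3) 0 = incl (n + 3) (gen (n + 2) 0) := by
      rw [incl_gen (by omega)]
      simp [zigzag]
    rw [h]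
    exact isSplitting_singleton _
  | succ d ih =>
    rw [List.replicate_succ', ← List.cons_append]
    refine isSplitting_append_singleton.2 ⟨?_, Or.inr ?_⟩
    · rw [← ih.2.1]
      have h := map_mul (incl (n + 3)) (δ (n + 2)) (gen (n + 2) 0)
      rw [incl_gen (by omega)] at h
      rw [← flip_zigzag_mul_δ, mul_assoc]
      exact congrArg _ h.symm
    · rw [← ih.2.1]
      exact ⟨ih, endsWithFirst_flip_zigzag_mul⟩

theorem isSplitting_zigzag (n d : ℕ) :
    IsSplitting (n := n + 3) (zigzag (n + 3) (d + 1)) (zigzagSplitting (n + 2) d) := by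
  have h : zigzagSplitting (n + 2) d =
      (gen (n + 2) 0 :: List.replicate d (δ (n + 2) * gen (n + 2) 0)) ++ [δ (n + 2)] ++ [1] := by
    simp [zigzagSplitting]
  have h1 := isSplitting_zigzagPrefix n d
  have h2 : IsSplitting (n := n + 3) (flip (n + 3) (zigzag (n + 3) (d + 1)))
      ((gen (n + 2) 0 :: List.replicate d (δ (n + 2) * gen (n + 2) 0)) ++ [δ (n + 2)]) := by
    refine isSplitting_append_singleton.2 ⟨?_, Or.inr ?_⟩
    · rw [← h1.2.1]
      exact flip_zigzag_mul_δ.symm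
    · rw [← h1.2.1]
      exact ⟨h1, endsWithFirst_flip_zigzag_mul⟩
  rw [h]
  refine isSplitting_append_singleton.2 ⟨?_, Or.inr ?_⟩
  -- The final entry 1 supplies only a flip: the zigzag itself ends with σ_{n-1}, so it is already
  -- reduced.
  · rw [← h2.2.1, flip_flip, map_one, mul_one]
  · rw [← h2.2.1]
    exact ⟨h2, endsWithFirst_flip_zigzag (by omega)⟩

/-! ### The order -/

theorem lt_of_isSplitting {n : ℕ} {x y : PosBraid (n + 3)} {s t : List (PosBraid (n + 2))}
    (hx : IsSplitting (n := n + 3) x s) (hy : IsSplitting (n := n + 3) y t)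
    (h : List.Shortlex (lt (n + 2)) s t) : lt (n + 3) x y :=
  ⟨s, t, hx, hy, h⟩

theorem shortlex_of_lt {n : ℕ} {x y : PosBraid (n + 3)} {s t : List (PosBraid (n + 2))}
    (hx : IsSplitting (n := n + 3) x s) (hy : IsSplitting (n := n + 3) y t)
    (h : lt (n + 3) x y) : List.Shortlex (lt (n + 2)) s t := by
  obtain ⟨s', t', hs, ht, h⟩ := h
  rwa [hx.unique (by omega) hs, hy.unique (by omega) ht]

theorem lex_or_eq_of_forall₂ {n : ℕ} {s t : List (PosBraid n)} (h : List.Forall₂ (le n) s t) :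
    List.Lex (lt n) s t ∨ s = t := by
  induction h with
  | nil => exact Or.inr rfl
  | cons hab _ ih =>
    rcases hab with hab | rfl
    · exact Or.inl (List.Lex.rel hab)
    · rcases ih with ih | rfl
      · exact Or.inl (List.Lex.cons ih)
      · exact Or.inr rfl

theorem le_of_forall₂ {n : ℕ} {x y : PosBraid (n + 3)} {s t : List (PosBraid (n + 2))}
    (hx : IsSplitting (n := n + 3) x s) (hy : IsSplitting (n := n + 3) y t)
    (h : List.Forall₂ (le (n + 2)) s t) : le (n + 3) x y := by
  rcases lex_or_eq_of_forall₂ h with h' | rfl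
  · exact Or.inl (lt_of_isSplitting hx hy (List.Shortlex.of_lex h.length_eq h'))
  · exact Or.inr (hx.2.1.trans hy.2.1.symm)

theorem le_of_length_lt {n : ℕ} {x y : PosBraid (n + 3)} {s t : List (PosBraid (n + 2))}
    (hx : IsSplitting (n := n + 3) x s) (hy : IsSplitting (n := n + 3) y t)
    (h : s.length < t.length) : le (n + 3) x y :=
  Or.inl (lt_of_isSplitting hx hy (List.Shortlex.of_length_lt h))

theorem exists_eq_pow (x : PosBraid 2) : ∃ a : ℕ, x = gen 2 0 ^ a := by
  induction x using right_induction with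
  | one => exact ⟨0, rfl⟩
  | mul_σ x i ih =>
    obtain ⟨a, rfl⟩ := ih
    refine ⟨a + 1, ?_⟩
    rw [pow_succ, show i = (0 : Fin 1) from Subsingleton.elim (α := Fin 1) i 0]
    rfl

theorem lt_two_iff {a b : ℕ} : lt 2 (gen 2 0 ^ a) (gen 2 0 ^ b) ↔ a < b := by
  have hg : (gen 2 0 : PosBraid 2) = σ 0 := rfl
  constructor
  · rintro ⟨p, q, hpq, hp, hq⟩
    have h1 := congrArg length hp
    have h2 := congrArg length hq
    rw [hg] at h1 h2
    simp only [length_pow, length_σ, mul_one] at h1 h2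
    omega
  · intro h
    exact ⟨a, b, h, rfl, rfl⟩

theorem le_two_of_le {a b : ℕ} (h : a ≤ b) : le 2 (gen 2 0 ^ a) (gen 2 0 ^ b) := by
  rcases h.lt_or_eq with h | rfl
  · exact Or.inl (lt_two_iff.2 h)
  · exact Or.inr rfl

instance lt_asymm (n : ℕ) : Std.Asymm (lt (n + 2)) := by
  induction n with
  | zero =>
    refine ⟨fun x y hxy hyx => ?_⟩
    obtain ⟨a, rfl⟩ := exists_eq_pow x
    obtain ⟨b, rfl⟩ := exists_eq_pow y
    rw [lt_two_iff] at hxy hyx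
    omega
  | succ n ih =>
    refine ⟨fun x y hxy hyx => ?_⟩
    obtain ⟨s, t, hs, ht, h⟩ := hxy
    exact Std.Asymm.asymm _ _ h (shortlex_of_lt ht hs hyx)

theorem exists_lt (n : ℕ) (x : PosBraid (n + 2)) : ∃ y, lt (n + 2) x y := by
  rcases n with _ | n
  · obtain ⟨a, rfl⟩ := exists_eq_pow x
    exact ⟨_, lt_two_iff.2 (Nat.lt_succ_self a)⟩
  · obtain ⟨s, hs⟩ := exists_isSplitting (by omega) x
    -- This zigzag has breadth `s.length + 3`.
    refine ⟨zigzag (n + 3) (s.length + 1), lt_of_isSplitting hs (isSplitting_zigzag n s.length)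
      (List.Shortlex.of_length_lt ?_)⟩
    rw [length_zigzagSplitting]
    omega

theorem isSplitting_incl {n : ℕ} (x : PosBraid (n + 2)) :
    IsSplitting (n := n + 3) (incl (n + 3) x) [x] :=
  isSplitting_singleton (n := n + 3) x

theorem one_le (n : ℕ) (x : PosBraid (n + 2)) : le (n + 2) 1 x := by
  induction n with
  | zero =>
    obtain ⟨a, rfl⟩ := exists_eq_pow x
    exact le_two_of_le a.zero_le
  | succ n ih =>
    obtain ⟨s, hs⟩ := exists_isSplitting (by omega) x
    have h1 : IsSplitting (n := n + 3) 1 [(1 : PosBraid (n + 2))] := isSplitting_incl 1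
    rcases s with _ | ⟨a, _ | ⟨b, s⟩⟩
    · exact absurd rfl hs.1
    · exact le_of_forall₂ h1 hs (.cons (ih a) .nil)
    · exact le_of_length_lt h1 hs (by simp)

/-- The braid `σ_1` is the least nontrivial braid. -/
theorem gen_zero_le (n : ℕ) {x : PosBraid (n + 2)} (hx : x ≠ 1) : le (n + 2) (gen (n + 2) 0) x := by
  induction n with
  | zero =>
    obtain ⟨a, rfl⟩ := exists_eq_pow x
    have ha : a ≠ 0 := by
      rintro rfl
      exact hx rfl
    simpa using le_two_of_le (Nat.one_le_iff_ne_zero.2 ha)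
  | succ n ih =>
    obtain ⟨s, hs⟩ := exists_isSplitting (by omega) x
    have h1 : IsSplitting (n := n + 3) (gen (n + 3) 0) [gen (n + 2) 0] := by
      rw [← incl_gen (by omega)]
      exact isSplitting_incl _
    rcases s with _ | ⟨a, _ | ⟨b, s⟩⟩
    · exact absurd rfl hs.1
    · refine le_of_forall₂ h1 hs (.cons (ih ?_) .nil)
      rintro rfl
      exact hx hs.2.1
    · exact le_of_length_lt h1 hs (by simp)

/-! ### Lower bounds for the middle entries -/

theorem EndsWithFirst.ne_one {n : ℕ} {x : PosBraid (n + 2)} (h : EndsWithFirst x) : x ≠ 1 := by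
  rintro rfl
  exact not_isRightDivisor_one _ ((h ⟨0, by omega⟩).2 rfl)

theorem gen_mul_incl_incl (n : ℕ) (x : PosBraid (n + 1)) :
    gen (n + 3) (n + 1) * incl (n + 3) (incl (n + 2) x) =
      incl (n + 3) (incl (n + 2) x) * gen (n + 3) (n + 1) := by
  induction x using right_induction with
  | one =>
    have h : incl (n + 3) (incl (n + 2) (1 : PosBraid (n + 1))) = 1 := rfl
    rw [h, mul_one, one_mul]
  | mul_σ x i ih =>
    have hi : (i : ℕ) < n := i.isLt
    have h : incl (n + 3) (incl (n + 2) (x * σ i)) =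
        incl (n + 3) (incl (n + 2) x) * gen (n + 3) i := by
      rw [← incl_gen (show (i : ℕ) < n + 2 - 1 by omega),
        ← incl_gen (show (i : ℕ) < n + 1 - 1 by omega), gen_val]
      exact (congrArg (incl (n + 3)) (map_mul (incl (n + 2)) x (σ i))).trans
        (map_mul (incl (n + 3)) _ _)
    rw [h, ← mul_assoc, ih, mul_assoc, mul_assoc, gen_comm (show (i : ℕ) + 2 ≤ n + 1 by omega)]

theorem isSplitting_gen_mul_incl {n : ℕ} (x : PosBraid (n + 2)) :
    IsSplitting (n := n + 3) (gen (n + 3) (n + 1) * incl (n + 3) x) [gen (n + 2) 0, x] := by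
  have e : eval (n + 3) [gen (n + 2) 0] = gen (n + 3) 0 :=
    (eval_singleton (n := n + 3) _).trans (incl_gen (by omega))
  rw [← List.singleton_append]
  refine isSplitting_append_singleton.2 ⟨?_, Or.inr ⟨?_, ?_⟩⟩
  · rw [e, flip_gen (by omega)]
    rfl
  · rw [e, ← incl_gen (by omega)]
    exact isSplitting_incl _
  · rw [e]
    exact endsWithFirst_gen

theorem δ_mul_pow_succ (n e : ℕ) : δ (n + 3) * gen (n + 3) 0 ^ e =
    gen (n + 3) (n + 1) * incl (n + 3) (δ (n + 2) * gen (n + 2) 0 ^ e) := by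
  rw [δ_succ, ← incl_gen (show 0 < n + 2 - 1 by omega), mul_assoc]
  congr 1
  exact ((map_mul (incl (n + 3)) _ _).trans (congrArg _ (map_pow (incl (n + 3)) _ _))).symm

/-- If `σ_1` is the only generator that can be a right divisor of `σ_m x`, with `x` in `B_m^+`,
then `x` is at least `δ_m σ_1^e`, unless it is `δ_m σ_1^{e'}` for some `e' < e`. -/
theorem δ_mul_pow_le_or (n e : ℕ) (x : PosBraid (n + 2)) :
    le (n + 2) (δ (n + 2) * gen (n + 2) 0 ^ e) x ∨
    (∃ e' < e, x = δ (n + 2) * gen (n + 2) 0 ^ e') ∨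
    ∃ i, 0 < i ∧ i < n + 2 ∧
      IsRightDivisor (gen (n + 3) i) (gen (n + 3) (n + 1) * incl (n + 3) x) := by
  induction n with
  | zero =>
    have hδ : ∀ a, δ 2 * gen 2 0 ^ a = gen 2 0 ^ (a + 1) := by
      intro a
      rw [pow_succ', δ_eq_desc]
      simp [desc]
    obtain ⟨a, rfl⟩ := exists_eq_pow x
    rcases a with _ | a
    · exact Or.inr (Or.inr ⟨1, by omega, by omega, 1, rfl⟩)
    · rcases Nat.lt_or_ge a e with h | h
      · exact Or.inr (Or.inl ⟨a, h, (hδ a).symm⟩)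
      · left
        rw [hδ]
        exact le_two_of_le (by omega)
  | succ n ih =>
    have hδ : IsSplitting (n := n + 3) (δ (n + 3) * gen (n + 3) 0 ^ e)
        [gen (n + 2) 0, δ (n + 2) * gen (n + 2) 0 ^ e] := by
      rw [δ_mul_pow_succ]
      exact isSplitting_gen_mul_incl _
    obtain ⟨s, hs⟩ := exists_isSplitting (by omega) x
    rcases s with _ | ⟨a, _ | ⟨b, _ | ⟨c, s⟩⟩⟩
    · exact absurd rfl hs.1
    -- A braid of breadth 1 commutes with the top generator, which thus becomes a right divisor.
    · refine Or.inr (Or.inr ⟨n + 2, by omega, by omega, incl (n + 4) x, ?_⟩)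
      have hx : x = incl (n + 3) a := hs.2.1.trans (eval_singleton (n := n + 3) a)
      rw [hx]
      exact gen_mul_incl_incl (n + 1) a
    · have ha : a ≠ 1 := by
        have h : EndsWithFirst (eval (n + 3) [a]) := hs.2.2 [a] [b] rfl (by simp) (by simp)
        rintro rfl
        exact h.ne_one rfl
      rcases gen_zero_le n ha with ha | rfl
      · exact Or.inl (Or.inl (lt_of_isSplitting hδ hs
          (List.Shortlex.of_lex rfl (List.Lex.rel ha))))
      -- When the first entry is exactly σ_1, `x` has the same shape as the braid under study, with
      -- one strand fewer, and the induction applies to `b`.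
      · have hx : x = gen (n + 3) (n + 1) * incl (n + 3) b :=
          hs.2.1.trans (isSplitting_gen_mul_incl b).2.1.symm
        rcases ih b with h | ⟨e', he, h⟩ | ⟨i, h0, hi, z, hz⟩
        · exact Or.inl (le_of_forall₂ hδ hs (.cons (Or.inr rfl) (.cons h .nil)))
        · refine Or.inr (Or.inl ⟨e', he, ?_⟩)
          rw [hx, h]
          exact (δ_mul_pow_succ n e').symm
        · refine Or.inr (Or.inr ⟨i, h0, by omega, gen (n + 4) (n + 2) * incl (n + 4) z, ?_⟩)
          rw [hx, hz, ← incl_gen (show i < n + 3 - 1 by omega), mul_assoc]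
          exact congrArg _ (map_mul (incl (n + 4)) z (gen (n + 3) i))
    · exact Or.inl (le_of_length_lt hδ hs (by simp))

/-! ### Splittings of given length -/

theorem eval_eq_of_endsWithFirst {n : ℕ} {t : List (PosBraid (n + 2))}
    (ht : EndsWithFirst (eval (n + 3) t)) (y : PosBraid (n + 2)) :
    ∃ g, eval (n + 3) (t ++ [y]) = g * (gen (n + 3) (n + 1) * incl (n + 3) y) := by
  obtain ⟨g, hg⟩ := (ht.isRightDivisor_gen (i := 0) (by omega)).2 rfl
  refine ⟨flip (n + 3) g, (eval_append_singleton (n := n + 3) t y).trans ?_⟩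
  rw [hg, map_mul, flip_gen (by omega), mul_assoc]
  rfl

theorem δ_mul_pow_le_of_endsWithFirst {n : ℕ} {t : List (PosBraid (n + 2))} {y : PosBraid (n + 2)}
    (ht : EndsWithFirst (eval (n + 3) t)) (hy : EndsWithFirst (eval (n + 3) (t ++ [y]))) (e : ℕ) :
    le (n + 2) (δ (n + 2) * gen (n + 2) 0 ^ e) y ∨
      ∃ e' < e, y = δ (n + 2) * gen (n + 2) 0 ^ e' := by
  rcases δ_mul_pow_le_or n e y with h | h | ⟨i, h0, hi, h⟩
  · exact Or.inl h
  · exact Or.inr h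
  · obtain ⟨g, hg⟩ := eval_eq_of_endsWithFirst ht y
    rw [hg] at hy
    exact absurd ((hy.isRightDivisor_gen (by omega)).1 (isRightDivisor_mul h g)) h0.ne'

/-- If `y` were this braid, the prefix would end with the full δ of `n + 3` strands. Its flip
quasi-commutes past `z`, leaving the top generator as a right divisor. -/
theorem ne_δ_of_endsWithFirst {n : ℕ} {t : List (PosBraid (n + 2))} {y z : PosBraid (n + 2)}
    (ht : EndsWithFirst (eval (n + 3) t))
    (hz : EndsWithFirst (eval (n + 3) (t ++ [y] ++ [z]))) : y ≠ δ (n + 2) := by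
  rintro rfl
  obtain ⟨g, hg⟩ := eval_eq_of_endsWithFirst ht (δ (n + 2))
  have hδ : IsRightDivisor (gen (n + 3) (n + 1)) (flip (n + 3) (δ (n + 3))) := by
    have := (isRightDivisor_gen_flip (n := n + 3) (i := 0) (by omega)).2
      (isRightDivisor_δ (by omega))
    exact this
  obtain ⟨w, hw⟩ := flip_δ_mul_incl (n := n + 3) z
  have h : eval (n + 3) (t ++ [δ (n + 2)] ++ [z]) =
      flip (n + 3) g * w * flip (n + 3) (δ (n + 3)) := by
    refine (eval_append_singleton (n := n + 3) _ z).trans ?_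
    rw [hg, ← δ_succ, map_mul, mul_assoc, hw, mul_assoc]
  rw [h] at hz
  exact absurd ((hz.isRightDivisor_gen (by omega)).1 (isRightDivisor_mul hδ _)) (by omega)

theorem forall₂_le_of_prefix {n d : ℕ} {t u : List (PosBraid (n + 2))} (hd : u.length = d + 2)
    (h0 : t ≠ [])
    (h : ∀ v w, t ++ u = v ++ w → v ≠ [] → w ≠ [] → EndsWithFirst (eval (n + 3) v)) :
    List.Forall₂ (le (n + 2)) (List.replicate d (δ (n + 2) * gen (n + 2) 0) ++ [δ (n + 2), 1])
      u := by
  induction d generalizing t u with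
  | zero =>
    obtain ⟨a, b, rfl⟩ := List.length_eq_two.1 hd
    have h1 := h t [a, b] rfl h0 (by simp)
    have h2 := h (t ++ [a]) [b] (by simp) (by simp) (by simp)
    refine .cons ?_ (.cons (one_le n b) .nil)
    -- With exponent 0 there is no exceptional case.
    rcases δ_mul_pow_le_of_endsWithFirst h1 h2 0 with h3 | ⟨e, he, -⟩
    · simpa using h3
    · omega
  | succ d ih =>
    obtain _ | ⟨a, _ | ⟨b, u⟩⟩ := u
    · simp at hd
    · simp at hd
    have hu : u ≠ [] := by
      rintro rfl
      simp at hd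
    have h1 := h t (a :: b :: u) rfl h0 (by simp)
    have h2 := h (t ++ [a]) (b :: u) (by simp) (by simp) (by simp)
    have h3 := h (t ++ [a] ++ [b]) u (by simp) (by simp) hu
    rw [List.replicate_succ, List.cons_append]
    refine .cons ?_ (ih (by simpa using hd) (t := t ++ [a]) (by simp) fun v w hvw => h v w ?_)
    -- With exponent 1 the only exception is δ, excluded because `b` is not the last entry.
    · rcases δ_mul_pow_le_of_endsWithFirst h1 h2 1 with h4 | ⟨e, he, h4⟩
      · simpa using h4
      · obtain rfl : e = 0 := by omega
        exact absurd (by simpa using h4) (ne_δ_of_endsWithFirst h1 h3)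
    · rw [← hvw]
      simp

/-- The zigzag is the least braid of its breadth. -/
theorem zigzag_le_of_length_eq {n d : ℕ} {x : PosBraid (n + 3)} {s : List (PosBraid (n + 2))}
    (hs : IsSplitting (n := n + 3) x s) (hd : s.length = d + 3) :
    le (n + 3) (zigzag (n + 3) (d + 1)) x := by
  obtain _ | ⟨a, s⟩ := s
  · simp at hd
  have hd' : s.length = d + 2 := by simpa using hd
  have hs' : s ≠ [] := by
    rintro rfl
    simp at hd'
  have h : ∀ v w, [a] ++ s = v ++ w → v ≠ [] → w ≠ [] → EndsWithFirst (eval (n + 3) v) :=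
    fun v w e => hs.2.2 v w e
  refine le_of_forall₂ (isSplitting_zigzag n d) hs (.cons (gen_zero_le n ?_)
    (forall₂_le_of_prefix hd' (by simp) h))
  rintro rfl
  exact (h [1] s rfl (by simp) hs').ne_one rfl

/-- A braid is exceeded by another one with the same breadth. -/
theorem exists_lt_of_isSplitting {n : ℕ} {x : PosBraid (n + 3)} {s : List (PosBraid (n + 2))}
    (hs : IsSplitting (n := n + 3) x s) : ∃ y t, IsSplitting (n := n + 3) y t ∧
      t.length = s.length ∧ lt (n + 3) x y := by
  rcases s.eq_nil_or_concat with rfl | ⟨s, a, rfl⟩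
  · exact absurd rfl hs.1
  rw [List.concat_eq_append] at hs ⊢
  obtain ⟨b, hb⟩ := exists_lt n a
  have ht : IsSplitting (n := n + 3) (flip (n + 3) (eval (n + 3) s) * incl (n + 3) b) (s ++ [b]) :=
    isSplitting_append_singleton.2 ⟨rfl, (isSplitting_append_singleton.1 hs).2⟩
  refine ⟨_, _, ht, by simp, lt_of_isSplitting hs ht (List.Shortlex.append_left ?_ s)⟩
  exact (List.shortlex_singleton_iff _ _).2 hb

end PosBraid

theorem proposition4p22 (n p : ℕ) (hn : 3 ≤ n) (hp : 2 ≤ p) :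
    PosBraid.IsLeastUpperBound
      {x : PosBraid n | ∃ q, PosBraid.HasBreadth x q ∧ q ≤ p}
      (PosBraid.zigzag n (p - 1)) := by
  obtain ⟨n, rfl⟩ : ∃ m, n = m + 3 := ⟨n - 3, by omega⟩
  obtain ⟨d, rfl⟩ : ∃ d, p = d + 2 := ⟨p - 2, by omega⟩
  have hz := PosBraid.isSplitting_zigzag n d
  have hl := PosBraid.length_zigzagSplitting (n + 2) d
  refine ⟨?_, fun c hc => ?_⟩
  · rintro x ⟨q, ⟨s, hs, rfl⟩, hq⟩
    exact PosBraid.le_of_length_lt hs hz (by omega)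
  · obtain ⟨s, hs⟩ := PosBraid.exists_isSplitting (by omega) c
    rcases Nat.lt_trichotomy s.length (d + 3) with h | h | h
    -- Here `c` has breadth at most `d + 2`, so the greater braid `y` of equal breadth lies in the
    -- set bounded by `c`.
    · obtain ⟨y, t, ht, hlen, hlt⟩ := PosBraid.exists_lt_of_isSplitting hs
      have asymm := (PosBraid.lt_asymm (n + 1)).asymm
      rcases hc y ⟨t.length, ⟨t, ht, rfl⟩, by omega⟩ with h' | rfl
      · exact (asymm _ _ hlt h').elim
      · exact (asymm _ _ hlt hlt).elim
    · exact PosBraid.zigzag_le_of_length_eq hs h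
    · exact PosBraid.le_of_length_lt hz hs (by omega)
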